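/- Let $n\ge 0$ and $k>0$ be integers and let $Q\in R_n=\mathbb C[x_1,\dots,x_n]$ be a nonzero homogeneous polynomial of degree $k$. Let $D_n$ be the Weyl algebra over $\mathbb C$ in $x_1,\dots,x_n$, and let $b_Q(s)$ be the Bernstein–Sato polynomial of $Q$, i.e. the monic polynomial $b(s)\in\mathbb C[s]$ of least degree for which there is $P(s)\in D_n[s]$ with $P(s)\bullet Q^{s+1}=b(s)\,Q^s$ in the module $R_n[Q^{-1},s]\,Q^s$, where $\partial_i\bullet (g\,Q^s)=\bigl(\partial_i(g)+s\,g\,\partial_i(Q)/Q\bigr)Q^s$. Let $D_{x,t}$ be the Weyl algebra in $x_1,\dots,x_n,t$, let $$J_{n+1}(Q)=\bigl\langle\, t-Q,\ \partial_i+\partial_i(Q)\,\partial_t\ (1\le i\le n)\bigr\rangle\subseteq D_{x,t}$$ (left ideal), and let $M=D_{x,t}/J_{n+1}(Q)$. For $l\in\mathbb Z$ let $F^l_\partial(D_{x,t})$ be the $\mathbb C$-span of all $x^\alpha\partial^\beta t^a\partial_t^b$ with $|\alpha|\le|\beta|+l$, and let $F^l_\partial(M)$ be its image in $M$. Put $\tilde{\mathcal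 E}=-\partial_1x_1-\dots-\partial_nx_n$. The $b$-function for integration of $M$ along $\partial_1,\dots,\partial_n$ is the monic polynomial $\tilde b(s)\in\mathbb C[s]$ of least degree such that $$\tilde b(\tilde{\mathcal E}+l)\cdot F^l_\partial(M)\subseteq F^{l-1}_\partial(M)\quad\text{for all } l\in\mathbb Z .$$ Then the $b$-function for integration of $M$ along $\partial_1,\dots,\partial_n$ exists, and $b_Q\bigl((-s-n)/k\bigr)$ is a multiple of it in $\mathbb C[s]$. -/

import Mathlib

open Polynomial

noncomputable section

/-! ### Weyl algebras over `ℂ` -/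

/-- The Heisenberg relations between the generators `x_j = ι (inl j)` and `∂_i = ι (inr i)`:
the `x_j` commute, the `∂_i` commute, and `∂_i x_j = x_j ∂_i + δ_{ij}`. -/
inductive WeylRel (σ : Type) [DecidableEq σ] :
    FreeAlgebra ℂ (σ ⊕ σ) → FreeAlgebra ℂ (σ ⊕ σ) → Prop
  | x_x (i j : σ) : WeylRel σ
      (FreeAlgebra.ι ℂ (Sum.inl i) * FreeAlgebra.ι ℂ (Sum.inl j))
      (FreeAlgebra.ι ℂ (Sum.inl j) * FreeAlgebra.ι ℂ (Sum.inl i))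
  | d_d (i j : σ) : WeylRel σ
      (FreeAlgebra.ι ℂ (Sum.inr i) * FreeAlgebra.ι ℂ (Sum.inr j))
      (FreeAlgebra.ι ℂ (Sum.inr j) * FreeAlgebra.ι ℂ (Sum.inr i))
  | d_x (i j : σ) : WeylRel σ
      (FreeAlgebra.ι ℂ (Sum.inr i) * FreeAlgebra.ι ℂ (Sum.inl j))
      (FreeAlgebra.ι ℂ (Sum.inl j) * FreeAlgebra.ι ℂ (Sum.inr i) + if i = j then 1 else 0)

/-- The Weyl algebra over `ℂ` in the variables `σ`. -/
abbrev Weyl (σ : Type) [DecidableEq σ] : Type := RingQuot (WeylRel σ)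

namespace Weyl

/-- The generator `x_i`. -/
def x {σ : Type} [DecidableEq σ] (i : σ) : Weyl σ :=
  RingQuot.mkAlgHom ℂ (WeylRel σ) (FreeAlgebra.ι ℂ (Sum.inl i))

/-- The generator `∂_i`. -/
def d {σ : Type} [DecidableEq σ] (i : σ) : Weyl σ :=
  RingQuot.mkAlgHom ℂ (WeylRel σ) (FreeAlgebra.ι ℂ (Sum.inr i))

theorem x_mul_x {σ : Type} [DecidableEq σ] (i j : σ) : (x i : Weyl σ) * x j = x j * x i := by
  simp only [x, ← map_mul]
  exact RingQuot.mkAlgHom_rel ℂ (WeylRel.x_x i j)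

theorem d_mul_d {σ : Type} [DecidableEq σ] (i j : σ) : (d i : Weyl σ) * d j = d j * d i := by
  simp only [d, ← map_mul]
  exact RingQuot.mkAlgHom_rel ℂ (WeylRel.d_d i j)

theorem d_mul_x {σ : Type} [DecidableEq σ] (i j : σ) :
    (d i : Weyl σ) * x j = x j * d i + if i = j then 1 else 0 := by
  have h := RingQuot.mkAlgHom_rel ℂ (WeylRel.d_x i j)
  split_ifs with hij <;> simpa [x, d, hij] using h

/-- The universal property: operators satisfying the Heisenberg relations
define a homomorphism out of the Weyl algebra. -/
def lift {σ : Type} [DecidableEq σ] {A : Type*} [Ring A] [Algebra ℂ A] (X D : σ → A)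
    (hxx : ∀ i j, X i * X j = X j * X i) (hdd : ∀ i j, D i * D j = D j * D i)
    (hdx : ∀ i j, D i * X j = X j * D i + if i = j then 1 else 0) : Weyl σ →ₐ[ℂ] A :=
  RingQuot.liftAlgHom ℂ ⟨FreeAlgebra.lift ℂ (Sum.elim X D), by
    intro a b h
    cases h with
    | x_x i j => simpa using hxx i j
    | d_d i j => simpa using hdd i j
    | d_x i j =>
      have h := hdx i j
      split_ifs at h ⊢ <;> simpa using h⟩

theorem lift_x {σ : Type} [DecidableEq σ] {A : Type*} [Ring A] [Algebra ℂ A] (X D : σ → A)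
    (hxx : ∀ i j, X i * X j = X j * X i) (hdd : ∀ i j, D i * D j = D j * D i)
    (hdx : ∀ i j, D i * X j = X j * D i + if i = j then 1 else 0) (i : σ) :
    lift X D hxx hdd hdx (x i) = X i := by
  simp [lift, x]

theorem lift_d {σ : Type} [DecidableEq σ] {A : Type*} [Ring A] [Algebra ℂ A] (X D : σ → A)
    (hxx : ∀ i j, X i * X j = X j * X i) (hdd : ∀ i j, D i * D j = D j * D i)
    (hdx : ∀ i j, D i * X j = X j * D i + if i = j then 1 else 0) (i : σ) :
    lift X D hxx hdd hdx (d i) = D i := by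
  simp [lift, d]

end Weyl

/-! ### The module `R_n[f⁻¹, s] • f^s` and the Bernstein-Sato polynomial -/

namespace BernsteinSato

/-- The homomorphism `g ↦ g + ∂_i(g) ε` from `R = ℂ[x_j : j ∈ σ]` to the dual numbers
over `R[f⁻¹]`. -/
def dualHom {σ : Type} [DecidableEq σ] (f : MvPolynomial σ ℂ) (i : σ) :
    MvPolynomial σ ℂ →ₐ[ℂ] TrivSqZeroExt (Localization.Away f) (Localization.Away f) :=
  MvPolynomial.aeval fun j =>
    TrivSqZeroExt.inl (algebraMap (MvPolynomial σ ℂ) _ (MvPolynomial.X j)) +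
      TrivSqZeroExt.inr (if i = j then 1 else 0)

theorem fst_dualHom {σ : Type} [DecidableEq σ] (f : MvPolynomial σ ℂ) (i : σ)
    (g : MvPolynomial σ ℂ) :
    (dualHom f i g).fst = algebraMap (MvPolynomial σ ℂ) (Localization.Away f) g := by
  have h : (TrivSqZeroExt.fstHom ℂ (Localization.Away f) (Localization.Away f)).comp
      (dualHom f i) = IsScalarTower.toAlgHom ℂ (MvPolynomial σ ℂ) (Localization.Away f) := by
    ext j
    by_cases hij : i = j <;> simp [dualHom, hij]
  exact DFunLike.congr_fun h g

theorem snd_dualHom {σ : Type} [DecidableEq σ] (f : MvPolynomial σ ℂ) (i : σ)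
    (g : MvPolynomial σ ℂ) :
    (dualHom f i g).snd =
      algebraMap (MvPolynomial σ ℂ) (Localization.Away f) (MvPolynomial.pderiv i g) := by
  induction g using MvPolynomial.induction_on with
  | C a =>
    rw [← MvPolynomial.algebraMap_eq, AlgHom.commutes, TrivSqZeroExt.algebraMap_eq_inl']
    simp
  | add p q hp hq => simp [hp, hq]
  | mul_X p j hp =>
    have hX : (dualHom f i (MvPolynomial.X j)).snd = if i = j then 1 else 0 := by
      by_cases hij : i = j <;> simp [dualHom, hij]
    rw [map_mul, TrivSqZeroExt.snd_mul, hp, fst_dualHom, fst_dualHom, hX, Derivation.leibniz,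
      MvPolynomial.pderiv_X, Pi.single_apply]
    by_cases hij : i = j
    · subst hij
      simp [mul_comm]
    · simp [hij, Ne.symm hij, mul_comm]

theorem isUnit_dualHom {σ : Type} [DecidableEq σ] (f : MvPolynomial σ ℂ) (i : σ)
    (y : Submonoid.powers f) : IsUnit (dualHom f i (y : MvPolynomial σ ℂ)) := by
  rw [TrivSqZeroExt.isUnit_iff_isUnit_fst, fst_dualHom]
  exact IsLocalization.map_units _ y

/-- The extension of `dualHom` to `R[f⁻¹]`. -/
def dualLift {σ : Type} [DecidableEq σ] (f : MvPolynomial σ ℂ) (i : σ) :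
    Localization.Away f →ₐ[ℂ] TrivSqZeroExt (Localization.Away f) (Localization.Away f) :=
  IsLocalization.liftAlgHom (M := Submonoid.powers f) (f := dualHom f i) (isUnit_dualHom f i)

theorem dualLift_algebraMap {σ : Type} [DecidableEq σ] (f : MvPolynomial σ ℂ) (i : σ)
    (g : MvPolynomial σ ℂ) : dualLift f i (algebraMap _ _ g) = dualHom f i g := by
  rw [dualLift, IsLocalization.liftAlgHom_apply, IsLocalization.lift_eq]
  rfl

theorem fst_dualLift {σ : Type} [DecidableEq σ] (f : MvPolynomial σ ℂ) (i : σ)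
    (g : Localization.Away f) : (dualLift f i g).fst = g := by
  have h : ((TrivSqZeroExt.fstHom ℂ (Localization.Away f) (Localization.Away f)).comp
      (dualLift f i) : Localization.Away f →+* Localization.Away f) = RingHom.id _ := by
    refine IsLocalization.ringHom_ext (Submonoid.powers f) (RingHom.ext fun p => ?_)
    simp only [RingHom.comp_apply, RingHom.coe_coe, AlgHom.comp_apply, dualLift_algebraMap,
      TrivSqZeroExt.fstHom_apply, fst_dualHom, RingHom.id_apply]
  exact DFunLike.congr_fun h g

/-- The partial derivative `∂/∂x_i` on `R[f⁻¹]`. -/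
def pderivAway {σ : Type} [DecidableEq σ] (f : MvPolynomial σ ℂ) (i : σ) :
    Derivation ℂ (Localization.Away f) (Localization.Away f) :=
  Derivation.mk'
    { toFun := fun g => (dualLift f i g).snd
      map_add' := fun g h => by simp
      map_smul' := fun c g => by simp }
    (fun g h => by
      simp [fst_dualLift, mul_comm])

theorem pderivAway_algebraMap {σ : Type} [DecidableEq σ] (f : MvPolynomial σ ℂ) (i : σ)
    (g : MvPolynomial σ ℂ) :
    pderivAway f i (algebraMap _ _ g) = algebraMap _ _ (MvPolynomial.pderiv i g) := by
  change (dualLift f i _).snd = _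
  rw [dualLift_algebraMap, snd_dualHom]

theorem pderivAway_comm {σ : Type} [DecidableEq σ] (f : MvPolynomial σ ℂ) (i j : σ)
    (g : Localization.Away f) :
    pderivAway f i (pderivAway f j g) = pderivAway f j (pderivAway f i g) := by
  have hR : ∀ p : MvPolynomial σ ℂ, MvPolynomial.pderiv i (MvPolynomial.pderiv j p) =
      MvPolynomial.pderiv j (MvPolynomial.pderiv i p) := by
    have h : ⁅(MvPolynomial.pderiv i : Derivation ℂ (MvPolynomial σ ℂ) (MvPolynomial σ ℂ)),
        (MvPolynomial.pderiv j : Derivation ℂ (MvPolynomial σ ℂ) (MvPolynomial σ ℂ))⁆ = 0 := by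
      apply MvPolynomial.derivation_ext
      intro l
      simp only [Derivation.commutator_apply, MvPolynomial.pderiv_X, Pi.single_apply]
      split_ifs <;> simp
    intro p
    have := DFunLike.congr_fun h p
    rwa [Derivation.commutator_apply, Derivation.zero_apply, sub_eq_zero] at this
  have key : ∀ h : Localization.Away f, ⁅pderivAway f i, pderivAway f j⁆ h = 0 := by
    intro h
    obtain ⟨⟨p, q⟩, hpq⟩ := IsLocalization.surj (Submonoid.powers f) h
    have hq := IsLocalization.map_units (Localization.Away f) q
    have hz : ∀ p : MvPolynomial σ ℂ,
        ⁅pderivAway f i, pderivAway f j⁆ (algebraMap _ (Localization.Away f) p) = 0 := by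
      intro p
      rw [Derivation.commutator_apply]
      simp only [pderivAway_algebraMap, hR, sub_self]
    have h1 := congrArg (fun y => ⁅pderivAway f i, pderivAway f j⁆ y) hpq
    simp only [hz, Derivation.leibniz, smul_eq_mul, mul_zero, zero_add] at h1
    exact (hq.mul_right_eq_zero).1 h1
  have := key g
  rwa [Derivation.commutator_apply, sub_eq_zero] at this

/-- The partial derivative `∂/∂x_i` on `R[f⁻¹, s] = R[f⁻¹][s]`, acting on coefficients. -/
def pderivS {σ : Type} [DecidableEq σ] (f : MvPolynomial σ ℂ) (i : σ) :
    Derivation ℂ (Localization.Away f)[X] (Localization.Away f)[X] :=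
  PolynomialModule.equivPolynomialSelf.compDer (pderivAway f i).mapCoeffs

theorem coeff_pderivS {σ : Type} [DecidableEq σ] (f : MvPolynomial σ ℂ) (i : σ)
    (g : (Localization.Away f)[X]) (m : ℕ) :
    (pderivS f i g).coeff m = pderivAway f i (g.coeff m) := rfl

theorem pderivS_C {σ : Type} [DecidableEq σ] (f : MvPolynomial σ ℂ) (i : σ)
    (g : Localization.Away f) : pderivS f i (C g) = C (pderivAway f i g) := by
  ext m
  rw [coeff_pderivS, coeff_C, coeff_C]
  split_ifs <;> simp

theorem pderivS_X {σ : Type} [DecidableEq σ] (f : MvPolynomial σ ℂ) (i : σ) :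
    pderivS f i X = 0 := by
  ext m
  rw [coeff_pderivS, coeff_X]
  split_ifs <;> simp

/-- The logarithmic derivative `∂_i(f) / f` in `R[f⁻¹]`. -/
def dlog {σ : Type} [DecidableEq σ] (f : MvPolynomial σ ℂ) (i : σ) : Localization.Away f :=
  algebraMap _ _ (MvPolynomial.pderiv i f) * IsLocalization.Away.invSelf f

theorem pderivAway_dlog_comm {σ : Type} [DecidableEq σ] (f : MvPolynomial σ ℂ) (i j : σ) :
    pderivAway f i (dlog f j) = pderivAway f j (dlog f i) := by
  set F : Localization.Away f := algebraMap _ _ f with hF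
  have hu : F * IsLocalization.Away.invSelf f = 1 := IsLocalization.Away.mul_invSelf f
  have hl : ∀ i, dlog f i * F = pderivAway f i F := by
    intro i
    rw [hF, pderivAway_algebraMap, dlog, mul_assoc, mul_comm _ (algebraMap _ _ f), hu, mul_one]
  have h1 := congrArg (pderivAway f i) (hl j)
  have h2 := congrArg (pderivAway f j) (hl i)
  rw [pderivAway_comm, ← h2] at h1
  simp only [Derivation.leibniz, smul_eq_mul, ← hl] at h1
  have h3 : F * pderivAway f i (dlog f j) = F * pderivAway f j (dlog f i) := by
    linear_combination h1
  calc _ = IsLocalization.Away.invSelf f * (F * pderivAway f i (dlog f j)) := by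
        linear_combination (-(pderivAway f i (dlog f j))) * hu
    _ = _ := by
        rw [h3]
        linear_combination (pderivAway f j (dlog f i)) * hu

/-- The action of `∂_i` on `R[f⁻¹, s] • f^s`, where `g ∈ R[f⁻¹, s]` stands for `g f^s`:
`∂_i • (g f^s) = (∂_i(g) + s g ∂_i(f) / f) f^s`. -/
def partialFs {σ : Type} [DecidableEq σ] (f : MvPolynomial σ ℂ) (i : σ) :
    Module.End ℂ (Localization.Away f)[X] :=
  (pderivS f i : (Localization.Away f)[X] →ₗ[ℂ] (Localization.Away f)[X]) +
    LinearMap.mulLeft ℂ (X * C (dlog f i))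

/-- The action of `x_i` on `R[f⁻¹, s] • f^s`. -/
def mulXFs {σ : Type} [DecidableEq σ] (f : MvPolynomial σ ℂ) (i : σ) :
    Module.End ℂ (Localization.Away f)[X] :=
  LinearMap.mulLeft ℂ (C (algebraMap (MvPolynomial σ ℂ) _ (MvPolynomial.X i)))

theorem partialFs_apply {σ : Type} [DecidableEq σ] (f : MvPolynomial σ ℂ) (i : σ)
    (g : (Localization.Away f)[X]) :
    partialFs f i g = pderivS f i g + X * C (dlog f i) * g := rfl

theorem pderivS_comm {σ : Type} [DecidableEq σ] (f : MvPolynomial σ ℂ) (i j : σ)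
    (g : (Localization.Away f)[X]) :
    pderivS f i (pderivS f j g) = pderivS f j (pderivS f i g) := by
  ext m
  simp only [coeff_pderivS, pderivAway_comm f i j]

/-- The action of the Weyl algebra on `R[f⁻¹, s] • f^s`. -/
def weylAction {σ : Type} [DecidableEq σ] (f : MvPolynomial σ ℂ) :
    Weyl σ →ₐ[ℂ] Module.End ℂ (Localization.Away f)[X] :=
  Weyl.lift (mulXFs f) (partialFs f)
    (fun i j => by
      ext1 g
      simp only [mulXFs, Module.End.mul_apply, LinearMap.mulLeft_apply]
      ring)
    (fun i j => by
      ext1 g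
      simp only [Module.End.mul_apply, partialFs_apply, map_add, Derivation.leibniz, pderivS_C,
        pderivS_X, smul_eq_mul, pderivS_comm f i j, pderivAway_dlog_comm f i j]
      ring)
    (fun i j => by
      ext1 g
      simp only [Module.End.mul_apply, LinearMap.add_apply, partialFs_apply, mulXFs,
        LinearMap.mulLeft_apply, Derivation.leibniz, pderivS_C, pderivAway_algebraMap,
        MvPolynomial.pderiv_X, Pi.single_apply, smul_eq_mul]
      by_cases hij : i = j
      · subst hij
        simp
        ring
      · simp [hij, Ne.symm hij]
        ring)

/-- The action of `P(s) = ∑ P_m s^m` in `D[s]` on `g(s) f^s`, where `s` acts by multiplication. -/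
def actS {σ : Type} [DecidableEq σ] (f : MvPolynomial σ ℂ) (P : (Weyl σ)[X])
    (g : (Localization.Away f)[X]) : (Localization.Away f)[X] :=
  P.sum fun m a => X ^ m * weylAction f a g

/-- The functional equation `P(s) • f^{s+1} = b(s) f^s` for some `P(s) ∈ D[s]`. -/
def FunctionalEquation {σ : Type} [DecidableEq σ] (f : MvPolynomial σ ℂ) (b : ℂ[X]) : Prop :=
  ∃ P : (Weyl σ)[X], actS f P (C (algebraMap (MvPolynomial σ ℂ) (Localization.Away f) f)) =
    b.map (algebraMap ℂ (Localization.Away f))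

end BernsteinSato

/-- `b` is the Bernstein-Sato polynomial of `f`: the monic polynomial of least degree for which
there is `P(s) ∈ D[s]` with `P(s) • f^{s+1} = b(s) f^s`. -/
def IsBernsteinSatoPolynomial {σ : Type} [DecidableEq σ] (f : MvPolynomial σ ℂ) (b : ℂ[X]) :
    Prop :=
  b.Monic ∧ BernsteinSato.FunctionalEquation f b ∧
    ∀ c : ℂ[X], c.Monic → BernsteinSato.FunctionalEquation f c → b.natDegree ≤ c.natDegree

/-! ### Integration along `∂_1, …, ∂_n` for `D_{x,t}`-modules

In `D_{x,t}` the variable `x_i` is indexed by `some i`, and `t` is indexed by `none`. -/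

/-- The Weyl algebra `D_{x,t}` in the variables `x_1, …, x_n, t`. -/
abbrev Dxt (n : ℕ) : Type := Weyl (Option (Fin n))

namespace Dxt

/-- The multiplication operator `t`. -/
def t (n : ℕ) : Dxt n := Weyl.x none

/-- The derivative `∂_t`. -/
def dt (n : ℕ) : Dxt n := Weyl.d none

/-- The multiplication operator `x_i`. -/
def x {n : ℕ} (i : Fin n) : Dxt n := Weyl.x (some i)

/-- The derivative `∂_i`. -/
def d {n : ℕ} (i : Fin n) : Dxt n := Weyl.d (some i)

/-- The monomial `x^α`. -/
def xPow {n : ℕ} (α : Fin n → ℕ) : Dxt n :=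
  Finset.univ.noncommProd (fun i => x i ^ α i)
    fun i _ j _ _ => (show Commute (x i) (x j) from Weyl.x_mul_x _ _).pow_pow _ _

/-- The monomial `∂^β`. -/
def dPow {n : ℕ} (β : Fin n → ℕ) : Dxt n :=
  Finset.univ.noncommProd (fun i => d i ^ β i)
    fun i _ j _ _ => (show Commute (d i) (d j) from Weyl.d_mul_d _ _).pow_pow _ _

/-- A polynomial in `x_1, …, x_n`, regarded as an element of `D_{x,t}`. -/
def ofPoly {n : ℕ} (p : MvPolynomial (Fin n) ℂ) : Dxt n :=
  ∑ α ∈ p.support, p.coeff α • xPow α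

/-- The left ideal `J_{n+1}(f)` generated by `t - f` and `∂_i + ∂_i(f) ∂_t`, `1 ≤ i ≤ n`
(`Ideal` means left ideal for a noncommutative ring). -/
def J {n : ℕ} (f : MvPolynomial (Fin n) ℂ) : Ideal (Dxt n) :=
  Ideal.span (insert (t n - ofPoly f)
    (Set.range fun i : Fin n => d i + ofPoly (MvPolynomial.pderiv i f) * dt n))

/-- The filtration `F^l_∂(D_{x,t})`: the span of all `x^α ∂^β t^a ∂_t^b` with `|α| ≤ |β| + l`. -/
def F (n : ℕ) (l : ℤ) : Submodule ℂ (Dxt n) :=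
  Submodule.span ℂ {P | ∃ (α β : Fin n → ℕ) (a b : ℕ),
    ((∑ i, α i : ℕ) : ℤ) ≤ ((∑ i, β i : ℕ) : ℤ) + l ∧
      P = xPow α * dPow β * t n ^ a * dt n ^ b}

/-- The filtration `F^l_∂(M)` induced on `M = D_{x,t} / I`. -/
def quotF {n : ℕ} (I : Ideal (Dxt n)) (l : ℤ) : Submodule ℂ (Dxt n ⧸ I) :=
  (F n l).map ((Submodule.mkQ I).restrictScalars ℂ)

/-- The operator `-∂_1 x_1 - ⋯ - ∂_n x_n`. -/
def eulerTilde (n : ℕ) : Dxt n := -∑ i : Fin n, d i * x i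

/-- `b(Ẽ + l) • F^l_∂(M) ⊆ F^{l-1}_∂(M)` for all `l`, where `Ẽ = -∂_1 x_1 - ⋯ - ∂_n x_n` and
`M = D_{x,t} / I`. -/
def LowersFiltration {n : ℕ} (I : Ideal (Dxt n)) (b : ℂ[X]) : Prop :=
  ∀ l : ℤ, ∀ u ∈ quotF I l,
    Polynomial.aeval (eulerTilde n + (l : Dxt n)) b • u ∈ quotF I (l - 1)

/-- `b` is the `b`-function for integration of `D_{x,t} / I` along `∂_1, …, ∂_n`: the monic
polynomial of least degree with `b(Ẽ + l) • F^l_∂(M) ⊆ F^{l-1}_∂(M)` for all `l`. -/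
def IsBFunctionForIntegration {n : ℕ} (I : Ideal (Dxt n)) (b : ℂ[X]) : Prop :=
  b.Monic ∧ LowersFiltration I b ∧
    ∀ c : ℂ[X], c.Monic → LowersFiltration I c → b.natDegree ≤ c.natDegree

end Dxt

end

noncomputable section

namespace Weyl

/-! Let `t` act on `R[Q⁻¹, s] Q^s` by `s ↦ s + 1`. Then `s` is the operator `-∂_t t`, `Q^{s+1} = t
Q^s`, and the annihilator of `Q^s` in `D_{x,t}` is exactly `J(Q)` (`annFs_eq_J`). So `P(s) Q^{s+1} =
b(s) Q^s` becomes `b(s)·1 = P(s) t·1` in `M = D_{x,t}/J(Q)`.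

Write `θ = ∑ x_i ∂_i`. Homogeneity puts `T = θ - k s` in `J(Q)` (`eulerT_mem_J`). Split the
coefficients of `P(s)` by `deg x_i = 1`, `deg ∂_i = -1`. A piece of degree `p` gives a class in `M`
that is an eigenvector of `T` with eigenvalue `p + k`, while `T` kills `b(s)·1`. Eigenspaces are
independent, so only `p = -k` contributes, and `b(s)·1 ∈ F^{-k} ⊆ F^{-1}` (`mk_aeval_s_mem`).

Modulo `J(Q)`, `s` equals `θ/k = (-Ẽ - n)/k`, so `b((-Ẽ - n)/k)·1 ∈ F^{-1}`. The relation `P Ẽ = (Ẽ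
+ l) P` for `P` homogeneous of degree `l` carries this from the generator to every `F^l`
(`lowersFiltration_of_mk_mem`). The polynomials lowering the filtration are closed under subtraction
and multiples; a nonzero one yields a monic one of least degree, which divides all the others. -/

theorem induction {σ : Type} [DecidableEq σ] {C : Weyl σ → Prop}
    (algebraMap : ∀ c : ℂ, C (algebraMap ℂ _ c)) (x : ∀ i, C (x i)) (d : ∀ i, C (d i))
    (mul : ∀ a b, C a → C b → C (a * b)) (add : ∀ a b, C a → C b → C (a + b))
    (a : Weyl σ) : C a := by
  obtain ⟨a, rfl⟩ := RingQuot.mkAlgHom_surjective ℂ (WeylRel σ) a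
  induction a using FreeAlgebra.induction with
  | grade0 c => simpa using algebraMap c
  | grade1 i => cases i with
    | inl i => exact x i
    | inr i => exact d i
  | mul a b ha hb => simpa using mul _ _ ha hb
  | add a b ha hb => simpa using add _ _ ha hb

end Weyl

/-! ### Commutation relations in `D_{x,t}` -/

namespace Dxt

variable {n : ℕ}

theorem commute_x_x (i j : Fin n) : Commute (x i) (x j) := Weyl.x_mul_x _ _

theorem commute_d_d (i j : Fin n) : Commute (d i) (d j) := Weyl.d_mul_d _ _

theorem commute_t_x (i : Fin n) : Commute (t n) (x i) := Weyl.x_mul_x _ _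

theorem commute_dt_d (i : Fin n) : Commute (dt n) (d i) := Weyl.d_mul_d _ _

theorem commute_dt_x (i : Fin n) : Commute (dt n) (x i) :=
  (Weyl.d_mul_x (none : Option (Fin n)) (some i)).trans (by simp [dt, x])

theorem commute_t_d (i : Fin n) : Commute (t n) (d i) :=
  ((Weyl.d_mul_x (some i : Option (Fin n)) none).trans (by simp [t, d])).symm

theorem d_mul_x (i j : Fin n) : d i * x j = x j * d i + if i = j then 1 else 0 :=
  (Weyl.d_mul_x (some i : Option (Fin n)) (some j)).trans (by simp [x, d])

theorem dt_mul_t : dt n * t n = t n * dt n + 1 :=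
  (Weyl.d_mul_x (none : Option (Fin n)) none).trans (by simp [t, dt])

theorem induction {C : Dxt n → Prop} (algebraMap : ∀ c : ℂ, C (algebraMap ℂ _ c))
    (x : ∀ i, C (x i)) (d : ∀ i, C (d i)) (t : C (t n)) (dt : C (dt n))
    (mul : ∀ a b, C a → C b → C (a * b)) (add : ∀ a b, C a → C b → C (a + b))
    (a : Dxt n) : C a :=
  Weyl.induction algebraMap (fun i => i.casesOn t x) (fun i => i.casesOn dt d) mul add a

/-! ### Polynomials in the Weyl algebra -/

theorem noncommProd_pow_zero {ι A : Type*} [Monoid A] (s : Finset ι) (f : ι → A) (comm) :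
    s.noncommProd (fun i => f i ^ (0 : ι → ℕ) i) comm = 1 := by
  rw [Finset.noncommProd_eq_pow_card s _ comm 1 (by simp), one_pow]

theorem noncommProd_pow_add {ι A : Type*} [Monoid A] (s : Finset ι) (f : ι → A)
    (hf : ∀ i j, Commute (f i) (f j)) (α β : ι → ℕ) (hαβ hα hβ) :
    s.noncommProd (fun i => f i ^ (α + β) i) hαβ =
      s.noncommProd (fun i => f i ^ α i) hα * s.noncommProd (fun i => f i ^ β i) hβ := by
  rw [← Finset.noncommProd_mul_distrib _ _ hα hβ fun i _ j _ _ => (hf _ _).pow_pow _ _]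
  exact Finset.noncommProd_congr rfl (fun i _ => by simp [pow_add]) _

theorem noncommProd_pow_single {ι A : Type*} [Fintype ι] [DecidableEq ι] [Monoid A] (f : ι → A)
    (i : ι) (comm) :
    Finset.univ.noncommProd (fun j => f j ^ (Pi.single i 1 : ι → ℕ) j) comm = f i := by
  have h : (Finset.univ.erase i).noncommProd (fun j => f j ^ (Pi.single i 1 : ι → ℕ) j)
      (comm.mono (by simp)) = 1 := by
    refine (Finset.noncommProd_eq_pow_card _ _ _ 1 fun j hj => ?_).trans (one_pow _)
    simp [Finset.ne_of_mem_erase hj]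
  rw [← Finset.noncommProd_erase_mul _ (Finset.mem_univ i)]
  refine (congrArg (· * _) h).trans ?_
  simp

theorem xPow_zero : xPow (0 : Fin n → ℕ) = 1 :=
  noncommProd_pow_zero _ _ _

theorem xPow_add (α β : Fin n → ℕ) : xPow (α + β) = xPow α * xPow β :=
  noncommProd_pow_add _ _ commute_x_x _ _ _ _ _

theorem xPow_single (i : Fin n) : xPow (Pi.single i 1) = x i :=
  noncommProd_pow_single _ _ _

theorem dPow_zero : dPow (0 : Fin n → ℕ) = 1 :=
  noncommProd_pow_zero _ _ _

theorem dPow_add (α β : Fin n → ℕ) : dPow (α + β) = dPow α * dPow β :=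
  noncommProd_pow_add _ _ commute_d_d _ _ _ _ _

theorem dPow_single (i : Fin n) : dPow (Pi.single i 1) = d i :=
  noncommProd_pow_single _ _ _

/-- The inclusion of `ℂ[x_1, …, x_n]` into `D_{x,t}`. -/
def polyHom (n : ℕ) : MvPolynomial (Fin n) ℂ →ₐ[ℂ] Dxt n :=
  AddMonoidAlgebra.lift ℂ (Dxt n) (Fin n →₀ ℕ)
    { toFun := fun α => xPow (α.toAdd : Fin n →₀ ℕ)
      map_one' := xPow_zero
      map_mul' := fun _ _ => xPow_add _ _ }

theorem polyHom_eq_ofPoly (p : MvPolynomial (Fin n) ℂ) : polyHom n p = ofPoly p :=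
  AddMonoidAlgebra.lift_apply _ _

theorem polyHom_monomial (α : Fin n →₀ ℕ) (c : ℂ) :
    polyHom n (MvPolynomial.monomial α c) = c • xPow α :=
  AddMonoidAlgebra.lift_single _ _ _

theorem polyHom_C (c : ℂ) : polyHom n (MvPolynomial.C c) = algebraMap ℂ (Dxt n) c :=
  (polyHom n).commutes c

theorem polyHom_X (i : Fin n) : polyHom n (MvPolynomial.X i) = x i := by
  rw [MvPolynomial.X, polyHom_monomial, one_smul, ← xPow_single]
  congr 1
  ext j
  simp [Finsupp.single_apply, Pi.single_apply, eq_comm]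

theorem commute_polyHom {a : Dxt n} (ha : ∀ i, Commute a (x i)) (p : MvPolynomial (Fin n) ℂ) :
    Commute a (polyHom n p) := by
  induction p using MvPolynomial.induction_on with
  | C c => rw [polyHom_C]; exact (Algebra.commutes' c a).symm
  | add p q hp hq => rw [map_add]; exact hp.add_right hq
  | mul_X p i hp => rw [map_mul, polyHom_X]; exact hp.mul_right (ha i)

theorem d_mul_polyHom (i : Fin n) (p : MvPolynomial (Fin n) ℂ) :
    d i * polyHom n p = polyHom n p * d i + polyHom n (MvPolynomial.pderiv i p) := by
  induction p using MvPolynomial.induction_on with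
  | C c =>
    rw [MvPolynomial.pderiv_C, map_zero, add_zero, polyHom_C]
    exact (Algebra.commutes' c (d i)).symm
  | add p q hp hq => simp only [map_add, mul_add, add_mul, hp, hq]; abel
  | mul_X p j hp =>
    rw [Derivation.leibniz, MvPolynomial.pderiv_X, map_mul, ← mul_assoc, hp, add_mul, mul_assoc,
      polyHom_X, d_mul_x, mul_add, mul_assoc, smul_eq_mul, smul_eq_mul, map_add, map_mul,
      mul_comm (MvPolynomial.X j), map_mul, polyHom_X, add_assoc]
    congr 3
    simp only [Pi.single_apply, eq_comm (a := i)]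
    split_ifs <;> simp

/-- The truncated exponent at `a = 0` is harmless, since its coefficient is then zero. -/
theorem dt_mul_t_pow (a : ℕ) : dt n * t n ^ a = t n ^ a * dt n + (a : ℂ) • t n ^ (a - 1) := by
  induction a with
  | zero => simp
  | succ a ih =>
    rw [pow_succ, ← mul_assoc, ih, add_mul, mul_assoc, dt_mul_t]
    cases a with
    | zero => simp
    | succ a => simp [mul_add, add_mul, pow_succ, add_smul, mul_assoc]; abel

theorem t_mul_dt_pow (a : ℕ) : t n * dt n ^ a = dt n ^ a * t n - (a : ℂ) • dt n ^ (a - 1) := by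
  induction a with
  | zero => simp
  | succ a ih =>
    rw [pow_succ, ← mul_assoc, ih, sub_mul, mul_assoc (dt n ^ a) (dt n), dt_mul_t]
    cases a with
    | zero => simp
    | succ a => simp [mul_add, add_mul, pow_succ, add_smul, mul_assoc]

/-! ### The grading by `deg x_i = 1`, `deg ∂_i = -1`, `deg t = deg ∂_t = 0` -/

theorem F_mono {l m : ℤ} (h : l ≤ m) : F n l ≤ F n m :=
  Submodule.span_mono fun _ ⟨α, β, a, b, hl, hP⟩ => ⟨α, β, a, b, by omega, hP⟩

theorem one_mem_F : (1 : Dxt n) ∈ F n 0 :=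
  Submodule.subset_span ⟨0, 0, 0, 0, by simp, by simp [xPow_zero, dPow_zero]⟩

/-- The Euler operator `x_1 ∂_1 + ⋯ + x_n ∂_n`. -/
def euler (n : ℕ) : Dxt n := ∑ i : Fin n, x i * d i

theorem eulerTilde_eq : eulerTilde n = -euler n - (n : Dxt n) := by
  have h : ∀ i : Fin n, d i * x i = x i * d i + 1 := fun i => by simpa using d_mul_x i i
  simp only [eulerTilde, euler, h, Finset.sum_add_distrib]
  simp
  abel

/-- Left multiplications that shift the filtration by `p`, and commute with the Euler operator
up to `p`. -/
def homog (n : ℕ) (p : ℤ) : Submodule ℂ (Dxt n) where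
  carrier := {P | (∀ m, ∀ u ∈ F n m, P * u ∈ F n (m + p)) ∧
    euler n * P = P * euler n + (p : ℂ) • P}
  add_mem' := fun ⟨h1, h2⟩ ⟨h3, h4⟩ =>
    ⟨fun m u hu => by rw [add_mul]; exact add_mem (h1 m u hu) (h3 m u hu), by
      rw [mul_add, h2, h4, add_mul, smul_add]; abel⟩
  zero_mem' := ⟨fun m u hu => by simp, by simp⟩
  smul_mem' := fun c P ⟨h1, h2⟩ =>
    ⟨fun m u hu => by rw [smul_mul_assoc]; exact Submodule.smul_mem _ _ (h1 m u hu), by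
      rw [mul_smul_comm, h2, smul_add, smul_mul_assoc, smul_comm]⟩

/-- A shift by `p` sends `1 ∈ F^0` into `F^p`. -/
theorem homog_le_F (p : ℤ) : homog n p ≤ F n p := fun P hP => by
  simpa using hP.1 0 1 one_mem_F

instance : SetLike.GradedMonoid (homog n) where
  one_mem := ⟨by simp, by simp⟩
  mul_mem := fun p q P R hP hR => by
    refine ⟨fun m u hu => ?_, ?_⟩
    · rw [mul_assoc, add_comm p q, ← add_assoc]
      exact hP.1 _ _ (hR.1 _ _ hu)
    · rw [← mul_assoc, hP.2, add_mul, mul_assoc, hR.2]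
      simp [mul_add, add_smul, mul_assoc]
      abel

theorem mul_mem_F_of_forall {p m : ℤ} {P : Dxt n}
    (h : ∀ (α β : Fin n → ℕ) (a b : ℕ), ((∑ i, α i : ℕ) : ℤ) ≤ ((∑ i, β i : ℕ) : ℤ) + m →
      P * (xPow α * dPow β * t n ^ a * dt n ^ b) ∈ F n (m + p)) {u : Dxt n} (hu : u ∈ F n m) :
    P * u ∈ F n (m + p) := by
  have : F n m ≤ (F n (m + p)).comap (LinearMap.mulLeft ℂ P) :=
    Submodule.span_le.2 fun u ⟨α, β, a, b, hl, hu⟩ => by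
      subst hu
      exact h α β a b hl
  exact this hu

theorem monomial_mem_F {α β : Fin n → ℕ} (a b : ℕ) {m : ℤ}
    (h : ((∑ i, α i : ℕ) : ℤ) ≤ ((∑ i, β i : ℕ) : ℤ) + m) :
    xPow α * dPow β * t n ^ a * dt n ^ b ∈ F n m :=
  Submodule.subset_span ⟨α, β, a, b, h, rfl⟩

theorem x_mem_homog (i : Fin n) : x i ∈ homog n 1 := by
  refine ⟨fun m u => mul_mem_F_of_forall fun α β a b h => ?_, ?_⟩
  · rw [← mul_assoc, ← mul_assoc, ← mul_assoc, ← xPow_single, ← xPow_add]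
    refine monomial_mem_F a b ?_
    simp only [Pi.add_apply, Finset.sum_add_distrib, Finset.sum_pi_single', Finset.mem_univ,
      if_true]
    push_cast at h ⊢
    omega
  · rw [euler, Finset.sum_mul, Finset.mul_sum]
    simp only [mul_assoc, d_mul_x, mul_add, Finset.sum_add_distrib]
    simp only [← mul_assoc, (commute_x_x _ i).eq]
    simp

theorem d_mul_xPow (i : Fin n) (α : Fin n → ℕ) :
    d i * xPow α = xPow α * d i + (α i : ℂ) • xPow (α - Pi.single i 1) := by
  obtain ⟨α, rfl⟩ : ∃ α' : Fin n →₀ ℕ, ⇑α' = α := ⟨Finsupp.equivFunOnFinite.symm α, rfl⟩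
  have h := d_mul_polyHom i (MvPolynomial.monomial α 1)
  rw [MvPolynomial.pderiv_monomial, polyHom_monomial, polyHom_monomial] at h
  have hα : ⇑(α - Finsupp.single i 1 : Fin n →₀ ℕ) = ⇑α - Pi.single i 1 := by
    ext j
    simp [Finsupp.single_apply, Pi.single_apply, eq_comm]
  rwa [one_smul, one_mul, hα] at h

theorem d_mem_homog (i : Fin n) : d i ∈ homog n (-1) := by
  refine ⟨fun m u => mul_mem_F_of_forall fun α β a b h => ?_, ?_⟩
  · rw [← mul_assoc, ← mul_assoc, ← mul_assoc, d_mul_xPow, add_mul, add_mul, add_mul, mul_assoc _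
      (d i), ← dPow_single, ← dPow_add]
    refine add_mem (monomial_mem_F a b ?_) ?_
    · simp only [Pi.add_apply, Finset.sum_add_distrib, Finset.sum_pi_single', Finset.mem_univ,
        if_true]
      push_cast at h ⊢
      omega
    -- When `α i = 0` truncated subtraction would not lower `|α|`, but the coefficient vanishes.
    · by_cases hi : α i = 0
      · simp [hi]
      · simp only [smul_mul_assoc]
        refine Submodule.smul_mem _ _ (monomial_mem_F a b ?_)
        have hα : α = (α - Pi.single i 1) + Pi.single i 1 := by
          ext j
          by_cases hj : j = i
          · subst hj; simp; omega
          · simp [hj]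
        rw [hα] at h
        simp only [Pi.add_apply, Finset.sum_add_distrib, Finset.sum_pi_single', Finset.mem_univ,
          if_true] at h
        push_cast at h ⊢
        omega
  · rw [euler, Finset.sum_mul, Finset.mul_sum]
    have h : ∀ j, d i * (x j * d j) = x j * d j * d i + if i = j then d j else 0 := fun j => by
      rw [← mul_assoc, d_mul_x, add_mul, mul_assoc, mul_assoc, (commute_d_d i j).eq]
      split_ifs <;> simp
    simp only [h, Finset.sum_add_distrib]
    simp [mul_assoc, add_assoc]
    module

theorem commute_t_euler : Commute (t n) (euler n) :=
  Commute.sum_right _ _ _ fun i _ => (commute_t_x i).mul_right (commute_t_d i)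

theorem commute_dt_euler : Commute (dt n) (euler n) :=
  Commute.sum_right _ _ _ fun i _ => (commute_dt_x i).mul_right (commute_dt_d i)

theorem commute_xPow {a : Dxt n} (ha : ∀ i, Commute a (x i)) (α : Fin n → ℕ) :
    Commute a (xPow α) :=
  Finset.noncommProd_commute _ _ _ _ fun i _ => (ha i).pow_right _

theorem commute_dPow {a : Dxt n} (ha : ∀ i, Commute a (d i)) (α : Fin n → ℕ) :
    Commute a (dPow α) :=
  Finset.noncommProd_commute _ _ _ _ fun i _ => (ha i).pow_right _

theorem t_mem_homog : t n ∈ homog n 0 := by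
  refine ⟨fun m u => mul_mem_F_of_forall fun α β a b h => ?_, ?_⟩
  · rw [← mul_assoc, ← mul_assoc, ((commute_xPow commute_t_x α).mul_right
      (commute_dPow commute_t_d β)).eq, mul_assoc _ (t n), ← pow_succ', add_zero]
    exact monomial_mem_F _ b h
  · simp [commute_t_euler.eq]

theorem dt_mem_homog : dt n ∈ homog n 0 := by
  refine ⟨fun m u => mul_mem_F_of_forall fun α β a b h => ?_, ?_⟩
  · rw [← mul_assoc, ← mul_assoc, ((commute_xPow commute_dt_x α).mul_right
      (commute_dPow commute_dt_d β)).eq, mul_assoc _ (dt n), dt_mul_t_pow, add_zero, mul_add,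
      add_mul, ← mul_assoc, mul_assoc _ (dt n), ← pow_succ', mul_smul_comm, smul_mul_assoc]
    exact add_mem (monomial_mem_F _ _ h) (Submodule.smul_mem _ _ (monomial_mem_F _ _ h))
  · simp [commute_dt_euler.eq]

theorem noncommProd_pow_mem {ι A : Type*} [Monoid A] {S : Type*} [SetLike S A] (H : ℤ → S)
    [SetLike.GradedMonoid H] {f : ι → A} {p : ℤ} (hf : ∀ i, f i ∈ H p) (α : ι → ℕ)
    (s : Finset ι) (comm) :
    s.noncommProd (fun i => f i ^ α i) comm ∈ H ((∑ i ∈ s, α i : ℕ) * p) := by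
  classical
  induction s using Finset.induction with
  | empty => simpa using SetLike.GradedOne.one_mem (A := H)
  | insert i s hi ih =>
    rw [Finset.noncommProd_insert_of_notMem _ _ _ _ hi, Finset.sum_insert hi, Nat.cast_add,
      add_mul, ← nsmul_eq_mul]
    exact SetLike.GradedMul.mul_mem (SetLike.pow_mem_graded _ (hf i)) (ih _)

/-- Shows that `F^l` is spanned by homogeneous elements of degree at most `l`. -/
theorem monomial_mem_homog (α β : Fin n → ℕ) (a b : ℕ) :
    xPow α * dPow β * t n ^ a * dt n ^ b ∈
      homog n (((∑ i, α i : ℕ) : ℤ) - ((∑ i, β i : ℕ) : ℤ)) := by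
  have : xPow α * dPow β * t n ^ a * dt n ^ b ∈ homog n _ :=
    SetLike.GradedMul.mul_mem (SetLike.GradedMul.mul_mem (SetLike.GradedMul.mul_mem
    (noncommProd_pow_mem (homog n) x_mem_homog α Finset.univ fun i _ j _ _ =>
      (commute_x_x i j).pow_pow _ _)
    (noncommProd_pow_mem (homog n) d_mem_homog β Finset.univ fun i _ j _ _ =>
      (commute_d_d i j).pow_pow _ _))
    (SetLike.pow_mem_graded a t_mem_homog)) (SetLike.pow_mem_graded b dt_mem_homog)
  convert this using 2
  simp
  ring

end Dxt

/-! ### The action of `D_{x,t}` on `R[f⁻¹, s] f^s` -/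

namespace BernsteinSato

section

variable {σ : Type} (f : MvPolynomial σ ℂ)

/-- The action of `t` on `R[f⁻¹, s] • f^s`: `t • (g(s) f^s) = g(s + 1) f^{s+1}`. -/
def tFs : Module.End ℂ (Localization.Away f)[X] :=
  LinearMap.mulLeft ℂ (C (algebraMap _ _ f)) ∘ₗ
    (taylor (1 : Localization.Away f)).restrictScalars ℂ

/-- The action of `∂_t` on `R[f⁻¹, s] • f^s`: `∂_t • (g(s) f^s) = -s g(s - 1) f^{s-1}`. -/
def dtFs : Module.End ℂ (Localization.Away f)[X] :=
  LinearMap.mulLeft ℂ (-(X * C (IsLocalization.Away.invSelf f))) ∘ₗ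
    (taylor (-1 : Localization.Away f)).restrictScalars ℂ

theorem tFs_apply (g : (Localization.Away f)[X]) :
    tFs f g = C (algebraMap _ _ f) * taylor (1 : Localization.Away f) g := rfl

theorem dtFs_apply (g : (Localization.Away f)[X]) :
    dtFs f g = -(X * C (IsLocalization.Away.invSelf f)) *
      taylor (-1 : Localization.Away f) g := rfl

theorem C_mul_invSelf :
    C (algebraMap _ (Localization.Away f) f) * C (IsLocalization.Away.invSelf f) = 1 := by
  rw [← C_mul, IsLocalization.Away.mul_invSelf, C_1]

/-- The two shifts of `s` cancel, as do `f` and `f⁻¹`. This is why `-∂_t t` plays the role of `s`.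
-/
theorem dtFs_tFs (g : (Localization.Away f)[X]) : dtFs f (tFs f g) = -(X * g) := by
  rw [dtFs_apply, tFs_apply, taylor_mul, taylor_taylor, taylor_C]
  simp only [neg_add_cancel, taylor_zero]
  linear_combination (-X * g) * C_mul_invSelf f

theorem tFs_dtFs (g : (Localization.Away f)[X]) : tFs f (dtFs f g) = -((X + 1) * g) := by
  rw [dtFs_apply, tFs_apply, taylor_mul, taylor_taylor, map_neg, taylor_mul, taylor_C,
    taylor_X]
  simp only [add_neg_cancel, taylor_zero, C_1]
  linear_combination (-(X + 1) * g) * C_mul_invSelf f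

end

section

variable {σ : Type} [DecidableEq σ] (f : MvPolynomial σ ℂ)

theorem pderivAway_invSelf (i : σ) :
    pderivAway f i (IsLocalization.Away.invSelf f) =
      -(dlog f i * IsLocalization.Away.invSelf f) := by
  have hu : algebraMap _ (Localization.Away f) f * IsLocalization.Away.invSelf f = 1 :=
    IsLocalization.Away.mul_invSelf f
  have h := congrArg (pderivAway f i) hu
  simp only [Derivation.leibniz, smul_eq_mul, Derivation.map_one_eq_zero,
    pderivAway_algebraMap] at h
  rw [dlog]
  linear_combination (IsLocalization.Away.invSelf f) * h -
    (pderivAway f i (IsLocalization.Away.invSelf f)) * hu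

theorem pderivAway_mul_dlog (i : σ) :
    algebraMap _ (Localization.Away f) f * dlog f i =
      algebraMap _ (Localization.Away f) (MvPolynomial.pderiv i f) := by
  have hu : algebraMap _ (Localization.Away f) f * IsLocalization.Away.invSelf f = 1 :=
    IsLocalization.Away.mul_invSelf f
  rw [dlog]
  linear_combination (algebraMap _ (Localization.Away f) (MvPolynomial.pderiv i f)) * hu

/-- Coefficientwise differentiation ignores a shift of `s` by a constant, because `X + C c` is
itself killed by it. -/
theorem pderivS_taylor (i : σ) {c : Localization.Away f} (hc : pderivAway f i c = 0)
    (g : (Localization.Away f)[X]) : pderivS f i (taylor c g) = taylor c (pderivS f i g) := by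
  have hc : pderivS f i (X + C c) = 0 := by
    rw [map_add, pderivS_X, pderivS_C, hc, C_0, add_zero]
  induction g using Polynomial.induction_on' with
  | add p q hp hq => simp only [map_add, hp, hq]
  | monomial m a =>
    rw [taylor_monomial, ← C_mul_X_pow_eq_monomial, Derivation.leibniz, Derivation.leibniz,
      Derivation.leibniz_pow, Derivation.leibniz_pow, hc, pderivS_X, pderivS_C]
    simp [taylor_mul, taylor_pow]
    exact mul_comm _ _

theorem mulXFs_apply (i : σ) (g : (Localization.Away f)[X]) :
    mulXFs f i g =
      C (algebraMap (MvPolynomial σ ℂ) (Localization.Away f) (MvPolynomial.X i)) * g := rfl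

/-- Shifting `s` adds one more `dlog f i`, which matches the derivative of the factor `f`. -/
theorem partialFs_tFs (i : σ) (g : (Localization.Away f)[X]) :
    partialFs f i (tFs f g) = tFs f (partialFs f i g) := by
  have h := congrArg (C : Localization.Away f → (Localization.Away f)[X])
    (pderivAway_mul_dlog f i)
  rw [C_mul] at h
  simp only [tFs_apply, partialFs_apply, Derivation.leibniz, pderivS_C, pderivAway_algebraMap,
    pderivS_taylor f i (Derivation.map_one_eq_zero _), map_add, taylor_mul, taylor_X, taylor_C,
    smul_eq_mul, ← h, map_one]
  ring

theorem partialFs_dtFs (i : σ) (g : (Localization.Away f)[X]) :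
    partialFs f i (dtFs f g) = dtFs f (partialFs f i g) := by
  have hc : pderivAway f i (-1) = 0 := by rw [map_neg, Derivation.map_one_eq_zero, neg_zero]
  simp only [dtFs_apply, partialFs_apply, Derivation.leibniz, pderivS_C, pderivAway_invSelf,
    pderivS_taylor f i hc, map_add, taylor_mul, taylor_X, taylor_C, smul_eq_mul, map_neg, map_one,
    pderivS_X, map_mul]
  ring

end

/-- The action of `D_{x,t}` on `R[f⁻¹, s] • f^s`, where `t` acts by `s ↦ s + 1`. -/
def dxtAction {n : ℕ} (f : MvPolynomial (Fin n) ℂ) :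
    Dxt n →ₐ[ℂ] Module.End ℂ (Localization.Away f)[X] :=
  Weyl.lift (σ := Option (Fin n)) (A := Module.End ℂ (Localization.Away f)[X])
    (fun i => i.elim (tFs f) (mulXFs f)) (fun i => i.elim (dtFs f) (partialFs f))
    (fun i j => by
      ext1 g
      cases i <;> cases j <;> simp only [Option.elim, Module.End.mul_apply, mulXFs_apply,
        tFs_apply, taylor_mul, taylor_C] <;> ring)
    (fun i j => by
      ext1 g
      cases i <;> cases j <;> simp only [Option.elim, Module.End.mul_apply, partialFs_dtFs]
      -- Only the `∂_i`, `∂_j` case is left; it is inherited from the action of `D_n`.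
      rename_i i j
      have h := congrArg (fun a => weylAction f a g) (Weyl.d_mul_d i j)
      simpa [weylAction, Weyl.lift_d] using h)
    (fun i j => by
      ext1 g
      cases i with
      | none => cases j with
        | none =>
          simp only [Option.elim, Module.End.mul_apply, dtFs_tFs, LinearMap.add_apply, tFs_dtFs,
            if_true, Module.End.one_apply]
          ring
        | some j =>
          simp [mulXFs_apply, dtFs_apply, taylor_mul]
          ring
      | some i => cases j with
        | none => simp [partialFs_tFs]
        | some j =>
          have h := congrArg (fun a => weylAction f a g) (Weyl.d_mul_x i j)
          by_cases hij : i = j <;> simpa [weylAction, Weyl.lift_d, Weyl.lift_x, hij] using h)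

section

variable {n : ℕ} (f : MvPolynomial (Fin n) ℂ)

theorem dxtAction_x (i : Fin n) : dxtAction f (Dxt.x i) = mulXFs f i := Weyl.lift_x ..

theorem dxtAction_d (i : Fin n) : dxtAction f (Dxt.d i) = partialFs f i := Weyl.lift_d ..

theorem dxtAction_t : dxtAction f (Dxt.t n) = tFs f := Weyl.lift_x ..

theorem dxtAction_dt : dxtAction f (Dxt.dt n) = dtFs f := Weyl.lift_d ..

/-- The inclusion of `D_n` into `D_{x,t}`. -/
def weylHom (n : ℕ) : Weyl (Fin n) →ₐ[ℂ] Dxt n :=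
  Weyl.lift Dxt.x Dxt.d Dxt.commute_x_x Dxt.commute_d_d Dxt.d_mul_x

theorem weylHom_x (i : Fin n) : weylHom n (Weyl.x i) = Dxt.x i := Weyl.lift_x ..

theorem weylHom_d (i : Fin n) : weylHom n (Weyl.d i) = Dxt.d i := Weyl.lift_d ..

theorem dxtAction_weylHom (a : Weyl (Fin n)) : dxtAction f (weylHom n a) = weylAction f a := by
  induction a using Weyl.induction with
  | algebraMap c => simp only [AlgHom.commutes]
  | x i => rw [weylHom_x, dxtAction_x, weylAction, Weyl.lift_x]
  | d i => rw [weylHom_d, dxtAction_d, weylAction, Weyl.lift_d]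
  | mul a b ha hb => simp only [map_mul, ha, hb]
  | add a b ha hb => simp only [map_add, ha, hb]

theorem dxtAction_polyHom (p : MvPolynomial (Fin n) ℂ) (g : (Localization.Away f)[X]) :
    dxtAction f (Dxt.polyHom n p) g = C (algebraMap _ _ p) * g := by
  induction p using MvPolynomial.induction_on generalizing g with
  | C c =>
    rw [Dxt.polyHom_C, AlgHom.commutes, ← MvPolynomial.algebraMap_eq,
      ← IsScalarTower.algebraMap_apply, Module.algebraMap_end_apply, ← smul_eq_C_mul,
      algebraMap_smul]
  | add p q hp hq => simp only [map_add, LinearMap.add_apply, hp, hq, add_mul]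
  | mul_X p i hp =>
    rw [map_mul, map_mul, Module.End.mul_apply, hp, Dxt.polyHom_X, dxtAction_x, mulXFs_apply,
      map_mul, map_mul, mul_assoc]

/-- The annihilator of `f^s` in `D_{x,t}`. -/
def annFs : Ideal (Dxt n) where
  carrier := {a | dxtAction f a 1 = 0}
  add_mem' := fun {a b} ha hb => by
    simp only [Set.mem_ofPred_eq] at ha hb ⊢
    rw [map_add, LinearMap.add_apply, ha, hb, add_zero]
  zero_mem' := by simp
  smul_mem' := fun a b hb => by
    simp only [Set.mem_ofPred_eq, smul_eq_mul] at hb ⊢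
    rw [map_mul, Module.End.mul_apply, hb, map_zero]

theorem mem_annFs {a : Dxt n} : a ∈ annFs f ↔ dxtAction f a 1 = 0 := Iff.rfl

theorem J_le_annFs : Dxt.J f ≤ annFs f := by
  refine Ideal.span_le.2 (Set.insert_subset ?_ ?_)
  · rw [SetLike.mem_coe, mem_annFs, ← Dxt.polyHom_eq_ofPoly, map_sub, LinearMap.sub_apply,
      dxtAction_polyHom, dxtAction_t, tFs_apply, taylor_one, C_1, sub_self]
  · rintro _ ⟨i, rfl⟩
    rw [SetLike.mem_coe, mem_annFs]
    beta_reduce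
    rw [← Dxt.polyHom_eq_ofPoly, map_add, LinearMap.add_apply,
      map_mul, Module.End.mul_apply, dxtAction_polyHom, dxtAction_d, dxtAction_dt, dtFs_apply,
      partialFs_apply, taylor_one, C_1, Derivation.map_one_eq_zero, dlog, C_mul]
    ring

/-- Each `∂_t` multiplies by `-s f⁻¹` after a shift, which preserves degree. Having one element in
each degree makes the `∂_t^j f^s` linearly independent over `R[f⁻¹]`. -/
theorem degree_dtFs_iterate [IsDomain (Localization.Away f)] (j : ℕ) :
    ((dtFs f ^ j) 1).degree = j := by
  have hinv : IsLocalization.Away.invSelf f ≠ (0 : Localization.Away f) := fun h => by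
    have := C_mul_invSelf f
    simp [h] at this
  induction j with
  | zero => simp
  | succ j ih =>
    rw [pow_succ', Module.End.mul_apply, dtFs_apply, degree_mul, degree_neg, degree_mul, degree_X,
      degree_C hinv, degree_taylor, ih]
    push_cast
    rw [add_zero, add_comm]

end

end BernsteinSato

/-! ### Normal forms modulo `J(f)`, and `J(f)` as an annihilator -/

namespace Dxt

variable {n : ℕ} (f : MvPolynomial (Fin n) ℂ)

/-- The operator `∑_j g_j ∂_t^j`. -/
def polyDt (n : ℕ) : (MvPolynomial (Fin n) ℂ)[X] →ₗ[ℂ] Dxt n :=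
  Polynomial.lsum fun j => LinearMap.mulRight ℂ (dt n ^ j) ∘ₗ (polyHom n).toLinearMap

theorem polyDt_monomial (j : ℕ) (p : MvPolynomial (Fin n) ℂ) :
    polyDt n (monomial j p) = polyHom n p * dt n ^ j := by
  simp [polyDt, Polynomial.lsum]

theorem t_sub_mem_J : t n - polyHom n f ∈ J f := by
  rw [polyHom_eq_ofPoly]
  exact Ideal.subset_span (Set.mem_insert _ _)

theorem d_add_mem_J (i : Fin n) : d i + polyHom n (MvPolynomial.pderiv i f) * dt n ∈ J f := by
  rw [polyHom_eq_ofPoly]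
  exact Ideal.subset_span (Set.mem_insert_of_mem _ ⟨i, rfl⟩)

/-- Modulo `J(f)`, a `t` on the far right becomes `f` and a `∂_i` there becomes `-∂_i(f) ∂_t`. Hence
operators `∑ g_j ∂_t^j` are stable under left multiplication by each generator, up to `J(f)`. -/
theorem mul_mem_range_sup_J (a : Dxt n) :
    ∀ v ∈ LinearMap.range (polyDt n) ⊔ (J f).restrictScalars ℂ,
      a * v ∈ LinearMap.range (polyDt n) ⊔ (J f).restrictScalars ℂ := by
  set S := LinearMap.range (polyDt n) ⊔ (J f).restrictScalars ℂ with hS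
  have hJ : ∀ v ∈ J f, v ∈ S := fun v hv =>
    (le_sup_right : (J f).restrictScalars ℂ ≤ S) hv
  have hP : ∀ j p, polyHom n p * dt n ^ j ∈ S := fun j p =>
    (le_sup_left : LinearMap.range (polyDt n) ≤ S) ⟨_, polyDt_monomial j p⟩
  have key : ∀ a : Dxt n, (∀ j p, a * (polyHom n p * dt n ^ j) ∈ S) → ∀ v ∈ S, a * v ∈ S := by
    intro a h v hv
    obtain ⟨_, ⟨g, rfl⟩, w, hw, rfl⟩ := Submodule.mem_sup.1 hv
    clear hv
    rw [mul_add]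
    refine add_mem ?_ (hJ _ ((J f).mul_mem_left a hw))
    induction g using Polynomial.induction_on' with
    | add p q hp hq => rw [map_add, mul_add]; exact add_mem hp hq
    | monomial j p => rw [polyDt_monomial]; exact h j p
  induction a using Dxt.induction with
  | algebraMap c =>
    intro v hv
    rw [← Algebra.smul_def]
    exact S.smul_mem c hv
  | mul a b ha hb => intro v hv; rw [mul_assoc]; exact ha _ (hb _ hv)
  | add a b ha hb => intro v hv; rw [add_mul]; exact add_mem (ha _ hv) (hb _ hv)
  | x i =>
    refine key _ fun j p => ?_
    rw [← polyHom_X, ← mul_assoc, ← map_mul]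
    exact hP _ _
  | dt =>
    refine key _ fun j p => ?_
    rw [← mul_assoc, (commute_polyHom commute_dt_x p).eq, mul_assoc, ← pow_succ']
    exact hP _ _
  | t =>
    refine key _ fun j p => ?_
    have h : t n * (polyHom n p * dt n ^ j) = polyHom n p * dt n ^ j * (t n - polyHom n f) +
        polyHom n (p * f) * dt n ^ j - (j : ℂ) • (polyHom n p * dt n ^ (j - 1)) := by
      rw [← mul_assoc, (commute_polyHom commute_t_x p).eq, mul_assoc, t_mul_dt_pow, map_mul,
        mul_assoc _ (polyHom n f), ← ((commute_polyHom commute_dt_x f).pow_left j).eq]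
      simp only [mul_sub, mul_smul_comm, mul_assoc]
      abel
    rw [h]
    exact sub_mem (add_mem (hJ _ (Ideal.mul_mem_left _ _ (t_sub_mem_J f))) (hP _ _))
      (S.smul_mem _ (hP _ _))
  | d i =>
    refine key _ fun j p => ?_
    have h : d i * (polyHom n p * dt n ^ j) =
        polyHom n p * dt n ^ j * (d i + polyHom n (MvPolynomial.pderiv i f) * dt n) -
        polyHom n (p * MvPolynomial.pderiv i f) * dt n ^ (j + 1) +
        polyHom n (MvPolynomial.pderiv i p) * dt n ^ j := by
      rw [← mul_assoc, d_mul_polyHom, add_mul, mul_assoc, ← ((commute_dt_d i).pow_left j).eq,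
        map_mul, pow_succ]
      have h := ((commute_polyHom commute_dt_x (MvPolynomial.pderiv i f)).pow_left j).eq
      simp only [mul_add, mul_assoc, ← mul_assoc (dt n ^ j) (polyHom n _), h]
      abel
    rw [h]
    exact add_mem (sub_mem (hJ _ (Ideal.mul_mem_left _ _ (d_add_mem_J f i))) (hP _ _)) (hP _ _)

theorem mem_range_sup_J (a : Dxt n) :
    a ∈ LinearMap.range (polyDt n) ⊔ (J f).restrictScalars ℂ := by
  have h1 : (1 : Dxt n) ∈ LinearMap.range (polyDt n) :=
    ⟨monomial 0 1, by rw [polyDt_monomial, map_one, pow_zero, one_mul]⟩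
  simpa using mul_mem_range_sup_J f a 1 (Submodule.mem_sup_left h1)

/-- `D_{x,t} / J(f)` embeds into `R[f⁻¹, s] • f^s`. -/
theorem annFs_eq_J (hf : f ≠ 0) : BernsteinSato.annFs f = J f := by
  refine le_antisymm (fun a ha => ?_) (BernsteinSato.J_le_annFs f)
  have hle : Submonoid.powers f ≤ nonZeroDivisors (MvPolynomial (Fin n) ℂ) :=
    powers_le_nonZeroDivisors_of_noZeroDivisors hf
  have : IsDomain (Localization.Away f) := IsLocalization.isDomain_localization hle
  obtain ⟨_, ⟨g, rfl⟩, w, hw, rfl⟩ := Submodule.mem_sup.1 (mem_range_sup_J f a)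
  have hg : polyDt n g ∈ BernsteinSato.annFs f :=
    (Submodule.add_mem_iff_left _ (BernsteinSato.J_le_annFs f hw)).1 ha
  -- An annihilating normal form `∑ g_j ∂_t^j` is a linear relation among the `∂_t^j f^s`, whose
  -- degrees in `s` are distinct, so every `g_j` vanishes.
  let w : Polynomial.Sequence (Localization.Away f) :=
    ⟨fun j => (BernsteinSato.dtFs f ^ j) 1, BernsteinSato.degree_dtFs_iterate f⟩
  have hsum : ∑ j ∈ g.support, algebraMap _ (Localization.Away f) (g.coeff j) • w j = 0 := by
    rw [← (BernsteinSato.mem_annFs f).1 hg]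
    conv_rhs => rw [← g.sum_monomial_eq, Polynomial.sum_def]
    simp only [map_sum, polyDt_monomial, map_mul, map_pow, BernsteinSato.dxtAction_dt,
      LinearMap.sum_apply, Module.End.mul_apply, BernsteinSato.dxtAction_polyHom, smul_eq_C_mul]
    rfl
  have hzero : g = 0 := by
    ext1 j
    by_cases hj : j ∈ g.support
    · have := linearIndependent_iff'.1 w.linearIndependent g.support _ hsum j hj
      exact IsLocalization.injective (Localization.Away f) hle (by rw [this, coeff_zero, map_zero])
    · simpa using hj
  rw [hzero, map_zero, zero_add]
  exact hw

end Dxt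

namespace Dxt

variable {n : ℕ}

/-! ### Polynomials lowering the filtration, and the minimal one -/

/-! ### Filtered pieces of quotients -/

theorem mk_mem_quotF {I : Ideal (Dxt n)} {l : ℤ} {P : Dxt n} (hP : P ∈ F n l) :
    (Submodule.Quotient.mk P : Dxt n ⧸ I) ∈ quotF I l :=
  ⟨P, hP, rfl⟩

theorem smul_mem_quotF {I : Ideal (Dxt n)} {p l : ℤ} {P : Dxt n} (hP : P ∈ homog n p)
    {u : Dxt n ⧸ I} (hu : u ∈ quotF I l) : P • u ∈ quotF I (l + p) := by
  obtain ⟨R, hR, rfl⟩ := hu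
  exact ⟨P * R, hP.1 _ _ hR, rfl⟩

theorem aeval_mem_homog {y : Dxt n} (hy : y ∈ homog n 0) (b : ℂ[X]) :
    aeval y b ∈ homog n 0 := by
  rw [aeval_eq_sum_range]
  exact sum_mem fun m _ => Submodule.smul_mem _ _ (by simpa using SetLike.pow_mem_graded m hy)

theorem euler_mem_homog : euler n ∈ homog n 0 :=
  sum_mem fun i _ => by
    simpa using SetLike.GradedMul.mul_mem (x_mem_homog i) (d_mem_homog i)

theorem algebraMap_mem_homog (c : ℂ) : algebraMap ℂ (Dxt n) c ∈ homog n 0 := by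
  rw [Algebra.algebraMap_eq_smul_one]
  exact Submodule.smul_mem _ _ (SetLike.GradedOne.one_mem (A := homog n))

theorem eulerTilde_add_mem_homog (l : ℤ) : eulerTilde n + (l : Dxt n) ∈ homog n 0 := by
  rw [eulerTilde_eq]
  have hn := algebraMap_mem_homog (n := n) (n : ℂ)
  have hl := algebraMap_mem_homog (n := n) (l : ℂ)
  rw [map_natCast] at hn
  rw [map_intCast] at hl
  exact add_mem (sub_mem (neg_mem euler_mem_homog) hn) hl

theorem semiconjBy_aeval {P y z : Dxt n} (h : SemiconjBy P y z) (b : ℂ[X]) :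
    SemiconjBy P (aeval y b) (aeval z b) := by
  induction b using Polynomial.induction_on' with
  | add p q hp hq => simpa using hp.add_right hq
  | monomial m c =>
    rw [aeval_monomial, aeval_monomial]
    exact SemiconjBy.mul_right (Algebra.commutes' c P).symm (h.pow_right m)

theorem semiconjBy_neg_sub_add {A : Type*} [Ring A] {e a c l : A} (h : e * a = a * e + l * a)
    (hc : Commute c a) : SemiconjBy a (-e - c) (-e - c + l) := by
  rw [SemiconjBy, add_mul, sub_mul, neg_mul, h, mul_sub, mul_neg, hc.eq]
  abel

theorem neg_mul_mul_self {A : Type*} [Ring A] {a b : A} (h : a * b = b * a + 1) :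
    -(a * b) * b = b * -(a * b) - b := by
  rw [mul_neg, ← mul_assoc, ← sub_eq_of_eq_add h]
  noncomm_ring

/-- Accounts for the shift `Ẽ + l` in the definition of the `b`-function. -/
theorem semiconjBy_eulerTilde {l : ℤ} {P : Dxt n} (hP : P ∈ homog n l) :
    SemiconjBy P (eulerTilde n) (eulerTilde n + (l : Dxt n)) := by
  have h := hP.2
  rw [Algebra.smul_def, map_intCast] at h
  rw [eulerTilde_eq]
  exact semiconjBy_neg_sub_add h (Nat.cast_commute n P)

/-- It suffices to check the condition on the generator, for `l = 0`. -/
theorem lowersFiltration_of_mk_mem {I : Ideal (Dxt n)} {b : ℂ[X]}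
    (h : (Submodule.Quotient.mk (aeval (eulerTilde n) b) : Dxt n ⧸ I) ∈ quotF I (-1)) :
    LowersFiltration I b := by
  rintro l _ ⟨P, hP, rfl⟩
  set φ := (Algebra.lsmul ℂ ℂ (Dxt n ⧸ I) (aeval (eulerTilde n + (l : Dxt n)) b)) ∘ₗ
    (Submodule.mkQ I).restrictScalars ℂ
  suffices F n l ≤ (quotF I (l - 1)).comap φ from this hP
  refine Submodule.span_le.2 ?_
  rintro _ ⟨α, β, a, c, hl, rfl⟩
  have hm := monomial_mem_homog α β a c
  set m := ((∑ i, α i : ℕ) : ℤ) - ((∑ i, β i : ℕ) : ℤ) with hm_def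
  change aeval (eulerTilde n + (l : Dxt n)) b • (Submodule.Quotient.mk _ : Dxt n ⧸ I) ∈
    quotF I (l - 1)
  -- In top degree `m = l`, move the monomial to the left of `b` and use the generator. In lower
  -- degree it already lies in `F^{l-1}`, which degree-zero operators preserve.
  rcases (show m ≤ l by omega).eq_or_lt with rfl | hlt
  · rw [← Submodule.Quotient.mk_smul, smul_eq_mul,
      ← (semiconjBy_aeval (semiconjBy_eulerTilde hm) b).eq, ← smul_eq_mul,
      Submodule.Quotient.mk_smul, sub_eq_neg_add]
    exact smul_mem_quotF hm h
  · rw [← add_zero (l - 1)]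
    exact smul_mem_quotF (aeval_mem_homog (eulerTilde_add_mem_homog l) b)
      (mk_mem_quotF (F_mono (by omega) (homog_le_F _ hm)))

theorem LowersFiltration.sub {I : Ideal (Dxt n)} {b c : ℂ[X]} (hb : LowersFiltration I b)
    (hc : LowersFiltration I c) : LowersFiltration I (b - c) := fun l u hu => by
  rw [map_sub, sub_smul]
  exact sub_mem (hb l u hu) (hc l u hu)

theorem LowersFiltration.mul_left {I : Ideal (Dxt n)} {b : ℂ[X]} (hb : LowersFiltration I b)
    (c : ℂ[X]) : LowersFiltration I (c * b) := fun l u hu => by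
  rw [map_mul, mul_smul, ← add_zero (l - 1)]
  exact smul_mem_quotF (aeval_mem_homog (eulerTilde_add_mem_homog l) c) (hb l u hu)

theorem LowersFiltration.normalize {I : Ideal (Dxt n)} {b : ℂ[X]} (hb : LowersFiltration I b) :
    LowersFiltration I (b * C b.leadingCoeff⁻¹) := by
  rw [mul_comm]
  exact hb.mul_left _

theorem exists_isBFunctionForIntegration {I : Ideal (Dxt n)} {c : ℂ[X]} (hc : c ≠ 0)
    (h : LowersFiltration I c) : ∃ b, IsBFunctionForIntegration I b := by
  obtain ⟨b, ⟨hb1, hb2⟩, hmin⟩ := (measure (natDegree (R := ℂ))).wf.has_min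
    {b | b.Monic ∧ LowersFiltration I b}
    ⟨c * C c.leadingCoeff⁻¹, monic_mul_leadingCoeff_inv hc, h.normalize⟩
  exact ⟨b, hb1, hb2, fun d hd1 hd2 => not_lt.1 (hmin d ⟨hd1, hd2⟩)⟩

/-- The remainder of `c` modulo `b` also lowers the filtration; if nonzero, normalizing it would
contradict minimality. -/
theorem IsBFunctionForIntegration.dvd {I : Ideal (Dxt n)} {b c : ℂ[X]}
    (hb : IsBFunctionForIntegration I b) (hc : LowersFiltration I c) : b ∣ c := by
  obtain ⟨hb1, hb2, hmin⟩ := hb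
  rw [← modByMonic_eq_zero_iff_dvd hb1]
  by_contra hr
  have hlow : LowersFiltration I (c %ₘ b) := by
    rw [modByMonic_eq_sub_mul_div, mul_comm]
    exact hc.sub (hb2.mul_left _)
  have h1 := hmin _ (monic_mul_leadingCoeff_inv hr) hlow.normalize
  rw [natDegree_mul_leadingCoeff_inv _ hr] at h1
  exact absurd (natDegree_lt_natDegree hr (degree_modByMonic_lt c hb1)) (not_lt.2 h1)

/-! ### The operator `s = -∂_t t` -/

/-- The operator `s = -∂_t t`. -/
def s (n : ℕ) : Dxt n := -(dt n * t n)

theorem dxtAction_s (f : MvPolynomial (Fin n) ℂ) (g : (Localization.Away f)[X]) :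
    BernsteinSato.dxtAction f (s n) g = X * g := by
  rw [s, map_neg, map_mul, LinearMap.neg_apply, Module.End.mul_apply,
    BernsteinSato.dxtAction_dt, BernsteinSato.dxtAction_t, BernsteinSato.dtFs_tFs, neg_neg]

theorem dxtAction_s_pow (f : MvPolynomial (Fin n) ℂ) (m : ℕ) (g : (Localization.Away f)[X]) :
    BernsteinSato.dxtAction f (s n ^ m) g = X ^ m * g := by
  induction m with
  | zero => simp
  | succ m ih => rw [pow_succ', map_mul, Module.End.mul_apply, ih, dxtAction_s, pow_succ', mul_assoc]

theorem dxtAction_aeval_s (f : MvPolynomial (Fin n) ℂ) (b : ℂ[X]) :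
    BernsteinSato.dxtAction f (aeval (s n) b) 1 = b.map (algebraMap ℂ (Localization.Away f)) := by
  induction b using Polynomial.induction_on' with
  | add p q hp hq => rw [map_add, map_add, LinearMap.add_apply, hp, hq, Polynomial.map_add]
  | monomial m c =>
    rw [aeval_monomial, ← Algebra.smul_def, map_smul, LinearMap.smul_apply, dxtAction_s_pow,
      mul_one, map_monomial, ← smul_X_eq_monomial, algebraMap_smul]

/-- The functional equation, as a congruence modulo `J(f)`. -/
theorem exists_sum_sub_mem_J {f : MvPolynomial (Fin n) ℂ} (hf : f ≠ 0) {b : ℂ[X]}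
    (h : BernsteinSato.FunctionalEquation f b) :
    ∃ P : (Weyl (Fin n))[X],
      P.sum (fun m a => s n ^ m * BernsteinSato.weylHom n a * t n) - aeval (s n) b ∈ J f := by
  obtain ⟨P, hP⟩ := h
  refine ⟨P, ?_⟩
  -- Membership in `J(f)` is tested on `f^s`, where the trailing `t` produces `f^{s+1}`.
  rw [← annFs_eq_J f hf, BernsteinSato.mem_annFs, map_sub, LinearMap.sub_apply,
    dxtAction_aeval_s, ← hP, sub_eq_zero, BernsteinSato.actS, Polynomial.sum_def,
    Polynomial.sum_def, map_sum, LinearMap.sum_apply]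
  refine Finset.sum_congr rfl fun m _ => ?_
  rw [map_mul, map_mul, Module.End.mul_apply, Module.End.mul_apply, dxtAction_s_pow,
    BernsteinSato.dxtAction_weylHom, BernsteinSato.dxtAction_t, BernsteinSato.tFs_apply,
    taylor_one, C_1, mul_one]

theorem s_mem_homog : s n ∈ homog n 0 := by
  simpa [s] using SetLike.GradedMul.mul_mem (dt_mem_homog (n := n)) t_mem_homog

theorem commute_s_euler : Commute (s n) (euler n) :=
  (commute_dt_euler.mul_left commute_t_euler).neg_left

/-! ### The grading of `D_n` -/

/-- Homogeneous elements of degree `p` that commute with `t` and `∂_t`. -/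
def homogX (n : ℕ) (p : ℤ) : Submodule ℂ (Dxt n) :=
  homog n p ⊓ Subalgebra.toSubmodule (Subalgebra.centralizer ℂ {t n, dt n})

theorem mem_homogX {p : ℤ} {a : Dxt n} :
    a ∈ homogX n p ↔ a ∈ homog n p ∧ Commute (t n) a ∧ Commute (dt n) a := by
  simp [homogX, Subalgebra.mem_centralizer_iff, Commute, SemiconjBy]

instance : SetLike.GradedMonoid (homogX n) where
  one_mem := ⟨SetLike.GradedOne.one_mem, one_mem (Subalgebra.centralizer ℂ {t n, dt n})⟩
  mul_mem := fun _ _ _ _ ha hb => ⟨SetLike.GradedMul.mul_mem ha.1 hb.1,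
    mul_mem (S := Subalgebra ℂ (Dxt n)) ha.2 hb.2⟩

theorem mul_mem_iSup {ι A : Type*} [AddMonoid ι] [Ring A] [Algebra ℂ A]
    (H : ι → Submodule ℂ A) [SetLike.GradedMonoid H] {a b : A} (ha : a ∈ ⨆ p, H p)
    (hb : b ∈ ⨆ p, H p) : a * b ∈ ⨆ p, H p := by
  induction ha using Submodule.iSup_induction' with
  | zero => simp
  | add a a' _ _ h h' => rw [add_mul]; exact add_mem h h'
  | mem p a ha =>
    induction hb using Submodule.iSup_induction' with
    | zero => simp
    | add b b' _ _ h h' => rw [mul_add]; exact add_mem h h'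
    | mem q b hb => exact Submodule.mem_iSup_of_mem (p + q) (SetLike.GradedMul.mul_mem ha hb)

theorem weylHom_mem_iSup (a : Weyl (Fin n)) : BernsteinSato.weylHom n a ∈ ⨆ p, homogX n p := by
  induction a using Weyl.induction with
  | algebraMap c =>
    rw [AlgHom.commutes, Algebra.algebraMap_eq_smul_one]
    exact Submodule.smul_mem _ _ (Submodule.mem_iSup_of_mem 0 SetLike.GradedOne.one_mem)
  | x i =>
    rw [BernsteinSato.weylHom_x]
    exact Submodule.mem_iSup_of_mem 1
      (mem_homogX.2 ⟨x_mem_homog i, commute_t_x i, commute_dt_x i⟩)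
  | d i =>
    rw [BernsteinSato.weylHom_d]
    exact Submodule.mem_iSup_of_mem (-1)
      (mem_homogX.2 ⟨d_mem_homog i, commute_t_d i, commute_dt_d i⟩)
  | mul a b ha hb => rw [map_mul]; exact mul_mem_iSup _ ha hb
  | add a b ha hb => rw [map_add]; exact add_mem ha hb

/-! ### The homogeneous case -/

section Homogeneous

variable {k : ℕ} {Q : MvPolynomial (Fin n) ℂ}

/-- The operator `x_1 ∂_1 + ⋯ + x_n ∂_n + k ∂_t t`. -/
def eulerT (n k : ℕ) : Dxt n := euler n - (k : ℂ) • s n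

/-- By Euler's identity, `∑ x_i (∂_i + ∂_i(Q) ∂_t) = θ + k Q ∂_t`; adding `k ∂_t (t - Q)` turns `Q
∂_t` into `∂_t t`. -/
theorem eulerT_mem_J (hQk : Q.IsHomogeneous k) : eulerT n k ∈ J Q := by
  have h1 : ∑ i, x i * (d i + polyHom n (MvPolynomial.pderiv i Q) * dt n) =
      euler n + (k : ℂ) • (polyHom n Q * dt n) := by
    have hE := congrArg (polyHom n) hQk.sum_X_mul_pderiv
    rw [map_sum, map_nsmul] at hE
    simp only [map_mul, polyHom_X] at hE
    simp only [mul_add, Finset.sum_add_distrib, ← mul_assoc, ← Finset.sum_mul, hE]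
    rw [euler, smul_mul_assoc, Nat.cast_smul_eq_nsmul]
  have h2 : eulerT n k = ∑ i, x i * (d i + polyHom n (MvPolynomial.pderiv i Q) * dt n) +
      ((k : ℂ) • dt n) * (t n - polyHom n Q) := by
    rw [h1, eulerT, s, ← (commute_polyHom commute_dt_x Q).eq, smul_mul_assoc, mul_sub, smul_sub,
      smul_neg]
    abel
  rw [h2]
  exact add_mem (sum_mem fun i _ => Ideal.mul_mem_left _ _ (d_add_mem_J Q i))
    (Ideal.mul_mem_left _ _ (t_sub_mem_J Q))

/-- The commutator with `θ` contributes `p`. As `a` commutes with `s` and `s t = t s - t`, the term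
`-k s` contributes `k`. -/
theorem eulerT_mul {p : ℤ} {a : Dxt n} (ha : a ∈ homogX n p) (m : ℕ) :
    eulerT n k * (s n ^ m * a * t n) =
      s n ^ m * a * t n * eulerT n k + ((p : ℂ) + k) • (s n ^ m * a * t n) := by
  have h1 : s n ^ m * a * t n ∈ homog n p := by
    simpa using SetLike.GradedMul.mul_mem (SetLike.GradedMul.mul_mem
      (SetLike.pow_mem_graded m (s_mem_homog (n := n))) ha.1) t_mem_homog
  have hc : Commute (s n) (s n ^ m * a) :=
    ((Commute.refl _).pow_right m).mul_right
      (((mem_homogX.1 ha).2.2.mul_left (mem_homogX.1 ha).2.1).neg_left)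
  have hst : s n * t n = t n * s n - t n := neg_mul_mul_self dt_mul_t
  have h2 : s n * (s n ^ m * a * t n) = s n ^ m * a * t n * s n - s n ^ m * a * t n := by
    rw [← mul_assoc, hc.eq, mul_assoc (s n ^ m * a), hst, mul_sub, ← mul_assoc]
  rw [eulerT, sub_mul, h1.2, smul_mul_assoc, h2, mul_sub, mul_smul_comm, add_smul, smul_sub]
  abel

/-- Since `eulerT` kills the generator of `M`, the degree-`p` part is an eigenvector for `p + k`.
The value `0` forces `p = -k ≤ -1`. -/
theorem mk_mem_sup_eigenspace (hk : 0 < k) (hQk : Q.IsHomogeneous k) (a : Weyl (Fin n)) (m : ℕ) :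
    (Submodule.Quotient.mk (s n ^ m * BernsteinSato.weylHom n a * t n) : Dxt n ⧸ J Q) ∈
      (quotF (J Q) (-1) ⊓ Module.End.eigenspace
          (Algebra.lsmul ℂ ℂ (Dxt n ⧸ J Q) (eulerT n k)) 0) ⊔
        ⨆ (μ : ℂ) (_ : μ ≠ 0),
          Module.End.eigenspace (Algebra.lsmul ℂ ℂ (Dxt n ⧸ J Q) (eulerT n k)) μ := by
  have ha := weylHom_mem_iSup a
  generalize BernsteinSato.weylHom n a = a at ha ⊢
  induction ha using Submodule.iSup_induction' with
  | zero => simp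
  | add a a' _ _ h h' =>
    rw [mul_add, add_mul, Submodule.Quotient.mk_add]
    exact add_mem h h'
  | mem p a ha =>
    have heig : (Submodule.Quotient.mk (s n ^ m * a * t n) : Dxt n ⧸ J Q) ∈
        Module.End.eigenspace (Algebra.lsmul ℂ ℂ (Dxt n ⧸ J Q) (eulerT n k)) ((p : ℂ) + k) := by
      rw [Module.End.mem_eigenspace_iff]
      change (Submodule.Quotient.mk (eulerT n k * _) : Dxt n ⧸ J Q) = _
      rw [eulerT_mul ha, Submodule.Quotient.mk_add, Submodule.Quotient.mk_smul,
        (Submodule.Quotient.mk_eq_zero _).2 (Ideal.mul_mem_left _ _ (eulerT_mem_J hQk)), zero_add]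
    by_cases hp : (p : ℂ) + k = 0
    · rw [hp] at heig
      refine Submodule.mem_sup_left ⟨mk_mem_quotF ?_, heig⟩
      have hp' : p + k = 0 := by exact_mod_cast hp
      have h1 : s n ^ m * a * t n ∈ homog n p := by
        simpa using SetLike.GradedMul.mul_mem (SetLike.GradedMul.mul_mem
          (SetLike.pow_mem_graded m (s_mem_homog (n := n))) ha.1) t_mem_homog
      exact F_mono (by omega) (homog_le_F _ h1)
    · exact Submodule.mem_sup_right (Submodule.mem_iSup_of_mem _ (Submodule.mem_iSup_of_mem hp heig))

theorem mk_aeval_s_mem (hk : 0 < k) (hQ : Q ≠ 0) (hQk : Q.IsHomogeneous k) {b : ℂ[X]}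
    (hb : BernsteinSato.FunctionalEquation Q b) :
    (Submodule.Quotient.mk (aeval (s n) b) : Dxt n ⧸ J Q) ∈ quotF (J Q) (-1) := by
  obtain ⟨P, hP⟩ := exists_sum_sub_mem_J hQ hb
  have hv := (Submodule.Quotient.eq _).2 hP
  set T := Algebra.lsmul ℂ ℂ (Dxt n ⧸ J Q) (eulerT n k)
  have hsup : (Submodule.Quotient.mk (aeval (s n) b) : Dxt n ⧸ J Q) ∈
      (quotF (J Q) (-1) ⊓ T.eigenspace 0) ⊔ ⨆ (μ : ℂ) (_ : μ ≠ 0), T.eigenspace μ := by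
    rw [← hv, Polynomial.sum_def, ← Submodule.mkQ_apply, map_sum]
    exact sum_mem fun m _ => mk_mem_sup_eigenspace hk hQk _ m
  have hzero : (Submodule.Quotient.mk (aeval (s n) b) : Dxt n ⧸ J Q) ∈ T.eigenspace 0 := by
    have hc : Commute (eulerT n k) (s n) :=
      commute_s_euler.symm.sub_left ((Commute.refl _).smul_left _)
    rw [Module.End.eigenspace_zero, LinearMap.mem_ker]
    change (Submodule.Quotient.mk (eulerT n k * _) : Dxt n ⧸ J Q) = 0
    rw [(semiconjBy_aeval hc b).eq]
    exact (Submodule.Quotient.mk_eq_zero _).2 (Ideal.mul_mem_left _ _ (eulerT_mem_J hQk))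
  -- The total and `v` both have eigenvalue `0`, hence so does `w`; but `w` is a sum of eigenvectors
  -- for nonzero eigenvalues, so `w = 0`.
  obtain ⟨v, hv, w, hw, hvw⟩ := Submodule.mem_sup.1 hsup
  have hw0 : w ∈ T.eigenspace 0 := by
    rw [← hvw] at hzero
    exact (Submodule.add_mem_iff_right _ hv.2).1 hzero
  have : w = 0 := Submodule.disjoint_def.1 (T.eigenspaces_iSupIndep 0) w hw0 hw
  rw [← hvw, this, add_zero]
  exact hv.1

theorem lowersFiltration_comp (hk : 0 < k) (hQ : Q ≠ 0) (hQk : Q.IsHomogeneous k) {b : ℂ[X]}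
    (hb : BernsteinSato.FunctionalEquation Q b) :
    LowersFiltration (J Q) (b.comp (C ((k : ℂ)⁻¹) * (-X - C (n : ℂ)))) := by
  refine lowersFiltration_of_mk_mem ?_
  have hk' : (k : ℂ) ≠ 0 := by exact_mod_cast hk.ne'
  have he : aeval (eulerTilde n) (C ((k : ℂ)⁻¹) * (-X - C (n : ℂ))) = (k : ℂ)⁻¹ • euler n := by
    rw [map_mul, aeval_C, ← Algebra.smul_def, map_sub, map_neg, aeval_X, aeval_C, eulerTilde_eq,
      map_natCast]
    congr 1
    abel
  rw [aeval_comp, he]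
  have hJ : (k : ℂ)⁻¹ • euler n - s n ∈ J Q := by
    have h : (k : ℂ)⁻¹ • euler n - s n = (k : ℂ)⁻¹ • eulerT n k := by
      rw [eulerT, smul_sub, inv_smul_smul₀ hk']
    rw [h, Algebra.smul_def]
    exact Ideal.mul_mem_left _ _ (eulerT_mem_J hQk)
  set e := (k : ℂ)⁻¹ • euler n
  have hc : Commute e (s n) := commute_s_euler.symm.smul_left _
  -- `J Q` is only a left ideal; commutation of `e` and `s` lets `e - s` be kept as the rightmost
  -- factor.
  have hpow : ∀ m : ℕ, e ^ m - s n ^ m ∈ J Q := by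
    intro m
    induction m with
    | zero => simp
    | succ m ih =>
      have h : e ^ (m + 1) - s n ^ (m + 1) = e ^ m * (e - s n) + s n * (e ^ m - s n ^ m) := by
        rw [mul_sub, mul_sub, (hc.pow_left m).eq, pow_succ, pow_succ']
        abel
      rw [h]
      exact add_mem (Ideal.mul_mem_left _ _ hJ) (Ideal.mul_mem_left _ _ ih)
  have heq : aeval e b - aeval (s n) b ∈ J Q := by
    simp only [aeval_eq_sum_range, ← Finset.sum_sub_distrib]
    refine sum_mem fun m _ => ?_
    rw [Algebra.smul_def, Algebra.smul_def, ← mul_sub]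
    exact Ideal.mul_mem_left _ _ (hpow m)
  rw [(Submodule.Quotient.eq _).2 heq]
  exact mk_aeval_s_mem hk hQ hQk hb

end Homogeneous

end Dxt

end

theorem mainTheorem6 (n k : ℕ) (hk : 0 < k) (Q : MvPolynomial (Fin n) ℂ) (hQ : Q ≠ 0)
    (hQk : Q.IsHomogeneous k) (bQ : Polynomial ℂ) (hbQ : IsBernsteinSatoPolynomial Q bQ) :
    (∃ b : Polynomial ℂ, Dxt.IsBFunctionForIntegration (Dxt.J Q) b) ∧
      ∀ b : Polynomial ℂ, Dxt.IsBFunctionForIntegration (Dxt.J Q) b →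
        b ∣ bQ.comp (Polynomial.C ((k : ℂ)⁻¹) * (-Polynomial.X - Polynomial.C (n : ℂ))) := by
  have hlow := Dxt.lowersFiltration_comp hk hQ hQk hbQ.2.1
  refine ⟨Dxt.exists_isBFunctionForIntegration (fun h => ?_) hlow, fun b hb => hb.dvd hlow⟩
  -- The composite vanishes only if `bQ = 0` or the inner polynomial is constant, but its linear
  -- coefficient is `-1/k`.
  rcases comp_eq_zero_iff.1 h with h0 | ⟨-, h1⟩
  · exact hbQ.1.ne_zero h0
  · have h2 := congrArg (fun p : ℂ[X] => p.coeff 1) h1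
    simp [coeff_C, hk.ne'] at h2
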